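/- A $k$-round two-prover quantum game $G$ with communication registers of $v_X$ and $v_Y$ qubits consists of unitaries $V_1,\dots,V_{k+1}$ acting on a private register of the verifier (with at least one qubit) and on the two communication registers $\mathrm{com}_X$ ($v_X$ qubits) and $\mathrm{com}_Y$ ($v_Y$ qubits). A $2m$-qubit strategy for $G$ is a triple $(|\psi\rangle,X,Y)$ of a unit vector $|\psi\rangle\in\mathbb{C}^{2^m}\otimes\mathbb{C}^{2^m}$ and sequences $X=(X_1,\dots,X_k)$, $Y=(Y_1,\dots,Y_k)$ of unitaries, where $X_j$ acts on $\mathrm{com}_X$ and on the first half of $|\psi\rangle$, and $Y_j$ acts on $\mathrm{com}_Y$ and on the second half of $|\psi\rangle$. The verifier's private register and the communication registers start in $|0\rangle$; round $j$ applies $V_j$ and then $X_j\otimes Y_j$; after round $k$, $V_{k+1}$ is applied. The value $\omega_G(|\psi\rangle,X,Y)$ is the probability that the verifier's first private qubit is then measured to be $1$. **Theorem.** For each $k$ and each $\varepsilon>0$ there is a family of $k$-round prover circuits $(\mathcal{X}_M,\mathcal{Y}_M)_{M\in\mathbb{N}}$ (defined for all sizes of the communication registers and of the provers' halves of $|\psi\rangle$,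 and acting on these together with one additional $M$-qubit program register for each prover) with the following properties. 1. The circuits are programmable: the unitary of each prover in each round has the form $\sum_{a\in\{0,1\}^M} |a\rangle\langle a|\otimes W_a$, where $|a\rangle$ ranges over the computational basis of the prover's program register and each $W_a$ is a unitary on the rest of that prover's registers. 2. For all $v_X,v_Y,m$ there is an $M_0$ such that for every $M\ge M_0$, every $k$-round two-prover quantum game $G$ with communication registers of $v_X$ and $v_Y$ qubits, and every $2m$-qubit strategy $(|\psi\rangle,X,Y)$ for $G$, there are computational basis states $|A\rangle_M$ and $|B\rangle_M$ of the two program registers such that $$\omega_G(|\psi\rangle|A\rangle_M|B\rangle_M,\mathcal{X}_M,\mathcal{Y}_M)\ \ge\ \omega_G(|\psi\rangle,X,Y)-\varepsilon .$$ -/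

import Mathlib

/-- Labels of the computational basis of an `n`-qubit register, so that `Qubits n → ℂ` is
`(ℂ²)^{⊗ n}`. The label of `|0⟩` is `fun _ => false`. -/
abbrev Qubits (n : ℕ) : Type := Fin n → Bool

/-- Amplitudes of a (normalized) pure state. -/
def IsState {ι : Type} [Fintype ι] (ψ : ι → ℂ) : Prop :=
  ∑ i, ‖ψ i‖ ^ 2 = 1

/-- The computational basis state `|a⟩`. -/
noncomputable def ket {n : ℕ} (a : Qubits n) : Qubits n → ℂ :=
  fun x => if x = a then 1 else 0

/-- The shared state `|ψ⟩|A⟩|B⟩`, where the first prover holds the first half of `ψ` together with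
`A`, and the second prover holds the second half of `ψ` together with `B`. -/
def withAncillas {P Q : Type} {M : ℕ} (ψ : P × Q → ℂ) (A B : Qubits M → ℂ) :
    (P × Qubits M) × (Q × Qubits M) → ℂ :=
  fun i => ψ (i.1.1, i.2.1) * A i.1.2 * B i.2.2

/-- The unitaries that a prover with private register `P` can apply: they act on her `c`-qubit
communication register and on her private register. -/
abbrev ProverUnitary (c : ℕ) (P : Type) [Fintype P] [DecidableEq P] : Type :=
  Matrix.unitaryGroup (Qubits c × P) ℂ

/-- A prover unitary whose private register is `P` together with an `M`-qubit program register is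
programmable if it is of the form `∑ₐ |a⟩⟨a| ⊗ W a`: the program qubits are only used as controls in
the computational basis, to select the unitary `W a` applied to the working register. -/
def IsProgrammable {c M : ℕ} {P : Type} [Fintype P] [DecidableEq P]
    (U : ProverUnitary c (P × Qubits M)) : Prop :=
  ∃ W : Qubits M → ProverUnitary c P, ∀ (x x' : Qubits c) (p p' : P) (a a' : Qubits M),
    U.1 (x, (p, a)) (x', (p', a')) = if a = a' then (W a).1 (x, p) (x', p') else 0

/-- A `k`-round two-prover quantum game with communication registers of `vX` and `vY` qubits.
The verifier has a private register of `r + 1` qubits, and `k + 1` unitary circuits acting on the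
private register and on the two communication registers. -/
structure QuantumGame (k vX vY : ℕ) where
  r : ℕ
  V : Fin (k + 1) → Matrix.unitaryGroup (Qubits (r + 1) × Qubits vX × Qubits vY) ℂ

/-- Basis labels of the whole system: private register of the verifier, the two communication
registers, and the private registers of the two provers. -/
abbrev Global (r vX vY : ℕ) (P Q : Type) : Type :=
  Qubits (r + 1) × Qubits vX × Qubits vY × P × Q

section Run

variable {r vX vY : ℕ} {P Q : Type}

/-- The initial state `|0⟩|0⟩|0⟩|ψ⟩`. -/
def initialState (ψ : P × Q → ℂ) : Global r vX vY P Q → ℂ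
  | (z, x, y, p, q) =>
    if z = (fun _ => false) ∧ x = (fun _ => false) ∧ y = (fun _ => false) then ψ (p, q) else 0

/-- Application of a verifier circuit (tensored with the identity on the provers' registers). -/
def verifierStep (U : Matrix.unitaryGroup (Qubits (r + 1) × Qubits vX × Qubits vY) ℂ)
    (φ : Global r vX vY P Q → ℂ) : Global r vX vY P Q → ℂ
  | (z, x, y, p, q) => ∑ z', ∑ x', ∑ y', U.1 (z, x, y) (z', x', y') * φ (z', x', y', p, q)

variable [Fintype P] [DecidableEq P] [Fintype Q] [DecidableEq Q]

/-- Simultaneous application of the provers' circuits, that is of `I ⊗ X ⊗ Y`. -/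
def proverStep (X : ProverUnitary vX P) (Y : ProverUnitary vY Q)
    (φ : Global r vX vY P Q → ℂ) : Global r vX vY P Q → ℂ
  | (z, x, y, p, q) => ∑ x', ∑ y', ∑ p', ∑ q',
      X.1 (x, p) (x', p') * Y.1 (y, q) (y', q') * φ (z, x', y', p', q')

/-- The state after `n` rounds; each round applies the verifier's circuit and then the provers'
circuits of that round. -/
def runRounds (ψ : P × Q → ℂ) : (n : ℕ) →
    (Fin n → Matrix.unitaryGroup (Qubits (r + 1) × Qubits vX × Qubits vY) ℂ) →
    (Fin n → ProverUnitary vX P) → (Fin n → ProverUnitary vY Q) → Global r vX vY P Q → ℂ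
  | 0, _, _, _ => initialState ψ
  | n + 1, V, X, Y =>
    proverStep (X (Fin.last n)) (Y (Fin.last n)) (verifierStep (V (Fin.last n))
      (runRounds ψ n (fun j => V j.castSucc) (fun j => X j.castSucc) (fun j => Y j.castSucc)))

end Run

/-- The value of the strategy `(ψ, X, Y)`: the probability that, after the `k` rounds and the last
verifier circuit, the first private qubit of the verifier is measured to be `1`. -/
noncomputable def QuantumGame.value {k vX vY : ℕ} (G : QuantumGame k vX vY) {P Q : Type}
    [Fintype P] [DecidableEq P] [Fintype Q] [DecidableEq Q] (ψ : P × Q → ℂ)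
    (X : Fin k → ProverUnitary vX P) (Y : Fin k → ProverUnitary vY Q) : ℝ :=
  ∑ g : Global G.r vX vY P Q, if g.1 0 = true then
    ‖verifierStep (G.V (Fin.last k)) (runRounds ψ k (fun j => G.V j.castSucc) X Y) g‖ ^ 2 else 0

/-! A prover's `k`-tuples of unitaries form a compact metric space, so a fixed dense sequence of
tuples contains, for every `δ`, a `δ`-net among finitely many initial terms (`exists_seq_net`). A
basis state of the program register encodes an index into this sequence, and running the controlled
circuit on it has exactly the value of the indexed tuple (`QuantumGame.value_withAncillas`).
Replacing all the tuples by `δ`-close ones costs at most `4kδ` in value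
(`QuantumGame.value_sub_le`). This bound depends neither on the game nor on the shared state, so one
net serves them all. -/

/-- A matrix acting on the first tensor factor of a decomposition `e` of the index set, tensored with
the identity on the second factor. -/
noncomputable def localApply {ι A B : Type} [Fintype A] (e : ι ≃ A × B) (D : Matrix A A ℂ)
    (φ : ι → ℂ) : ι → ℂ :=
  fun i => ∑ a, D (e i).1 a * φ (e.symm (a, (e i).2))

/-- The Euclidean norm of a vector of amplitudes. -/
noncomputable def l2norm {ι : Type} [Fintype ι] (φ : ι → ℂ) : ℝ := ‖WithLp.toLp 2 φ‖

/-! ### Norm estimates for local operators -/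

section L2

variable {ι A B : Type} [Fintype A]

lemma localApply_sub (e : ι ≃ A × B) (D : Matrix A A ℂ) (φ χ : ι → ℂ) :
    localApply e D (φ - χ) = localApply e D φ - localApply e D χ := by
  ext i; simp [localApply, mul_sub, Finset.sum_sub_distrib]

lemma sub_localApply (e : ι ≃ A × B) (D E : Matrix A A ℂ) (φ : ι → ℂ) :
    localApply e (D - E) φ = localApply e D φ - localApply e E φ := by
  ext i; simp [localApply, sub_mul, Finset.sum_sub_distrib]

variable [Fintype ι]

lemma l2norm_sq (φ : ι → ℂ) : l2norm φ ^ 2 = ∑ i, ‖φ i‖ ^ 2 := by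
  simp [l2norm, EuclideanSpace.norm_sq_eq]

lemma l2norm_nonneg (φ : ι → ℂ) : 0 ≤ l2norm φ := norm_nonneg _

lemma l2norm_add_le (φ χ : ι → ℂ) : l2norm (φ + χ) ≤ l2norm φ + l2norm χ := by
  simpa [l2norm] using norm_add_le (WithLp.toLp 2 φ) (WithLp.toLp 2 χ)

lemma abs_l2norm_sub_le (φ χ : ι → ℂ) : |l2norm φ - l2norm χ| ≤ l2norm (φ - χ) := by
  simpa [l2norm] using abs_norm_sub_norm_le (WithLp.toLp 2 φ) (WithLp.toLp 2 χ)

variable [Fintype B] [DecidableEq A]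

-- Fixing the label of the second factor cuts `φ` into slices on which `D` acts separately; the
-- squared bounds for the slices add up.
open scoped Matrix.Norms.L2Operator in
lemma l2norm_localApply_le (e : ι ≃ A × B) (D : Matrix A A ℂ) (φ : ι → ℂ) :
    l2norm (localApply e D φ) ≤ ‖D‖ * l2norm φ := by
  refine le_of_sq_le_sq ?_ (mul_nonneg (norm_nonneg _) (l2norm_nonneg _))
  rw [mul_pow, l2norm_sq, l2norm_sq, ← e.symm.sum_comp, ← e.symm.sum_comp (fun i => ‖φ i‖ ^ 2),
    Fintype.sum_prod_type_right, Fintype.sum_prod_type_right, Finset.mul_sum]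
  refine Finset.sum_le_sum fun b _ => ?_
  have h := Matrix.l2_opNorm_mulVec D (WithLp.toLp 2 fun a => φ (e.symm (a, b)))
  have h2 := pow_le_pow_left₀ (norm_nonneg _) h 2
  rw [mul_pow, EuclideanSpace.norm_sq_eq, EuclideanSpace.norm_sq_eq] at h2
  simpa [localApply, Matrix.mulVec, dotProduct] using h2

open scoped Matrix.Norms.L2Operator in
lemma l2norm_localApply_unitary_le [Nonempty A] (e : ι ≃ A × B)
    (U : Matrix.unitaryGroup A ℂ) (φ : ι → ℂ) :
    l2norm (localApply e U.1 φ) ≤ l2norm φ := by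
  refine (l2norm_localApply_le e U.1 φ).trans ?_
  have : ‖U.1‖ ≤ 1 := (CStarRing.norm_of_mem_unitary U.2).le
  nlinarith [l2norm_nonneg φ]

end L2


/-! ### Compactness and finite nets -/

open scoped Matrix.Norms.L2Operator in
lemma compactSpace_unitaryGroup (A : Type) [Fintype A] [DecidableEq A] :
    CompactSpace (Matrix.unitaryGroup A ℂ) := by
  have : ProperSpace (Matrix A A ℂ) := FiniteDimensional.proper ℂ _
  refine isCompact_iff_compactSpace.mp
    (Metric.isCompact_of_isClosed_isBounded (s := (Matrix.unitaryGroup A ℂ : Set (Matrix A A ℂ)))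
      (isClosed_unitary (R := Matrix A A ℂ)) ?_)
  -- Unitaries have norm one only in a nontrivial matrix ring, so empty `A` is treated apart.
  cases isEmpty_or_nonempty A
  · exact Set.subsingleton_of_subsingleton.finite.isBounded
  · refine isBounded_iff_forall_norm_le.mpr ⟨1, fun U hU => ?_⟩
    exact (CStarRing.norm_of_mem_unitary hU).le

open scoped Matrix.Norms.L2Operator in
/-- There is a sequence of `k`-tuples of unitaries such that, for every `δ > 0`, finitely many of its
terms form a `δ`-net in operator norm. -/
lemma exists_seq_net (A : Type) [Fintype A] [DecidableEq A] (k : ℕ) :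
    ∃ s : ℕ → Fin k → Matrix.unitaryGroup A ℂ, ∀ δ : ℝ, 0 < δ → ∃ N : ℕ,
      ∀ X : Fin k → Matrix.unitaryGroup A ℂ, ∃ n < N, ∀ j, ‖(s n j).1 - (X j).1‖ ≤ δ := by
  have := compactSpace_unitaryGroup A
  refine ⟨TopologicalSpace.denseSeq _, fun δ hδ => ?_⟩
  obtain ⟨t, ht⟩ := isCompact_univ.elim_finite_subcover
    (fun n => Metric.ball (TopologicalSpace.denseSeq (Fin k → Matrix.unitaryGroup A ℂ) n) δ)
    (fun _ => Metric.isOpen_ball) fun X _ => by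
      obtain ⟨n, hn⟩ := (TopologicalSpace.denseRange_denseSeq _).exists_dist_lt X hδ
      exact Set.mem_iUnion.mpr ⟨n, hn⟩
  refine ⟨t.sup id + 1, fun X => ?_⟩
  obtain ⟨n, hnt, hn⟩ := Set.mem_iUnion₂.mp (ht (Set.mem_univ X))
  refine ⟨n, Nat.lt_succ_of_le (Finset.le_sup (f := id) hnt), fun j => ?_⟩
  have h := (dist_le_pi_dist X (TopologicalSpace.denseSeq _ n) j).trans (Metric.mem_ball.mp hn).le
  rwa [dist_comm, Subtype.dist_eq, dist_eq_norm] at h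

/-! ### Controlled unitaries -/

section Programs

variable {c M : ℕ} {P : Type} [Fintype P] [DecidableEq P]

/-- The programmable unitary `∑ₐ |a⟩⟨a| ⊗ W a`. -/
def programUnitary (W : Qubits M → ProverUnitary c P) : ProverUnitary c (P × Qubits M) :=
  ⟨(Matrix.blockDiagonal fun a => (W a).1).submatrix
      (Equiv.prodAssoc (Qubits c) P (Qubits M)).symm (Equiv.prodAssoc (Qubits c) P (Qubits M)).symm, by
    have h : ∀ a, (W a).1 * star (W a).1 = 1 := fun a => Matrix.mem_unitaryGroup_iff.mp (W a).2
    rw [Matrix.mem_unitaryGroup_iff, Matrix.star_eq_conjTranspose, Matrix.conjTranspose_submatrix,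
      Matrix.submatrix_mul_equiv, Matrix.blockDiagonal_conjTranspose, ← Matrix.blockDiagonal_mul]
    simp_rw [← Matrix.star_eq_conjTranspose, h]
    erw [Matrix.blockDiagonal_one]
    simp⟩

lemma programUnitary_apply (W : Qubits M → ProverUnitary c P) (x x' : Qubits c) (p p' : P)
    (a a' : Qubits M) :
    (programUnitary W).1 (x, (p, a)) (x', (p', a')) =
      if a = a' then (W a).1 (x, p) (x', p') else 0 := by
  simp [programUnitary, Matrix.blockDiagonal_apply]

lemma isProgrammable_programUnitary (W : Qubits M → ProverUnitary c P) :
    IsProgrammable (programUnitary W) :=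
  ⟨W, programUnitary_apply W⟩

end Programs

/-! ### Programs in basis states select a strategy -/

section Simulation

variable {r vX vY M : ℕ} {P Q : Type}

/-- The state `φ|a⟩|b⟩` of the whole system, program registers included. -/
noncomputable def withPrograms (a b : Qubits M) (φ : Global r vX vY P Q → ℂ) :
    Global r vX vY (P × Qubits M) (Q × Qubits M) → ℂ
  | (z, x, y, p, q) => φ (z, x, y, p.1, q.1) * ket a p.2 * ket b q.2

lemma initialState_withAncillas (ψ : P × Q → ℂ) (a b : Qubits M) :
    (initialState (withAncillas ψ (ket a) (ket b)) : Global r vX vY _ _ → ℂ) =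
      withPrograms a b (initialState ψ) := by
  ext ⟨z, x, y, p, q⟩
  simp only [initialState, withAncillas, withPrograms]
  split_ifs <;> simp

lemma verifierStep_withPrograms
    (U : Matrix.unitaryGroup (Qubits (r + 1) × Qubits vX × Qubits vY) ℂ) (a b : Qubits M)
    (φ : Global r vX vY P Q → ℂ) :
    verifierStep U (withPrograms a b φ) = withPrograms a b (verifierStep U φ) := by
  ext ⟨z, x, y, p, q⟩
  simp only [verifierStep, withPrograms, Finset.sum_mul, mul_assoc]

variable [Fintype P] [Fintype Q]

lemma sum_norm_sq_withPrograms (a b : Qubits M) (φ : Global r vX vY P Q → ℂ) :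
    (∑ g, if g.1 0 = true then ‖withPrograms a b φ g‖ ^ 2 else 0) =
      ∑ g, if g.1 0 = true then ‖φ g‖ ^ 2 else 0 := by
  simp only [Fintype.sum_prod_type, withPrograms, ket, mul_ite, mul_one, mul_zero]
  refine Finset.sum_congr rfl fun z _ => Finset.sum_congr rfl fun x _ =>
    Finset.sum_congr rfl fun y _ => Finset.sum_congr rfl fun p _ => ?_
  split_ifs with h
  · rw [Finset.sum_comm]
    refine Finset.sum_congr rfl fun q _ => ?_
    rw [Finset.sum_eq_single a (by intro c _ hc; simp [hc]) (by simp),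
      Finset.sum_eq_single b (by intro c _ hc; simp [hc]) (by simp)]
    simp
  · simp

variable [DecidableEq P] [DecidableEq Q]

/-- A control in a basis state picks out a single block and is left unchanged, so the same program
remains available in later rounds. -/
lemma proverStep_withPrograms (W : Qubits M → ProverUnitary vX P)
    (Z : Qubits M → ProverUnitary vY Q) (a b : Qubits M) (φ : Global r vX vY P Q → ℂ) :
    proverStep (programUnitary W) (programUnitary Z) (withPrograms a b φ) =
      withPrograms a b (proverStep (W a) (Z b) φ) := by
  ext ⟨z, x, y, ⟨p, a'⟩, ⟨q, b'⟩⟩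
  simp only [proverStep, withPrograms, Fintype.sum_prod_type, programUnitary_apply, ket,
    mul_ite, ite_mul, mul_one, mul_zero, zero_mul, Finset.sum_ite_eq',
    Finset.mem_univ, if_true]
  by_cases ha : a' = a <;> by_cases hb : b' = b <;> simp [ha, hb]

lemma runRounds_withPrograms (ψ : P × Q → ℂ) (a b : Qubits M) (n : ℕ)
    (V : Fin n → Matrix.unitaryGroup (Qubits (r + 1) × Qubits vX × Qubits vY) ℂ)
    (W : Fin n → Qubits M → ProverUnitary vX P) (Z : Fin n → Qubits M → ProverUnitary vY Q) :
    runRounds (withAncillas ψ (ket a) (ket b)) n V (fun j => programUnitary (W j))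
        (fun j => programUnitary (Z j)) =
      withPrograms a b (runRounds ψ n V (fun j => W j a) (fun j => Z j b)) := by
  induction n with
  | zero => exact initialState_withAncillas ψ a b
  | succ n ih =>
    simp only [runRounds]
    rw [ih, verifierStep_withPrograms, proverStep_withPrograms]

lemma QuantumGame.value_withAncillas {k : ℕ} (G : QuantumGame k vX vY) (ψ : P × Q → ℂ)
    (a b : Qubits M) (W : Fin k → Qubits M → ProverUnitary vX P)
    (Z : Fin k → Qubits M → ProverUnitary vY Q) :
    G.value (withAncillas ψ (ket a) (ket b)) (fun j => programUnitary (W j))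
        (fun j => programUnitary (Z j)) =
      G.value ψ (fun j => W j a) (fun j => Z j b) := by
  simp only [QuantumGame.value]
  rw [runRounds_withPrograms, verifierStep_withPrograms, sum_norm_sq_withPrograms]

end Simulation

/-! ### Stability of the value under perturbation -/

section Robustness

variable {r vX vY : ℕ} {P Q : Type}

/-- The verifier's registers as a tensor factor of the whole system. -/
def verifierEquiv : Global r vX vY P Q ≃ (Qubits (r + 1) × Qubits vX × Qubits vY) × (P × Q) where
  toFun g := ((g.1, g.2.1, g.2.2.1), g.2.2.2)
  invFun g := (g.1.1, g.1.2.1, g.1.2.2, g.2)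
  left_inv _ := rfl
  right_inv _ := rfl

/-- The first prover's registers as a tensor factor of the whole system. -/
def firstProverEquiv : Global r vX vY P Q ≃ (Qubits vX × P) × (Qubits (r + 1) × Qubits vY × Q) where
  toFun g := ((g.2.1, g.2.2.2.1), (g.1, g.2.2.1, g.2.2.2.2))
  invFun g := (g.2.1, g.1.1, g.2.2.1, g.1.2, g.2.2.2)
  left_inv _ := rfl
  right_inv _ := rfl

/-- The second prover's registers as a tensor factor of the whole system. -/
def secondProverEquiv : Global r vX vY P Q ≃ (Qubits vY × Q) × (Qubits (r + 1) × Qubits vX × P) where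
  toFun g := ((g.2.2.1, g.2.2.2.2), (g.1, g.2.1, g.2.2.2.1))
  invFun g := (g.2.1, g.2.2.1, g.1.1, g.2.2.2, g.1.2)
  left_inv _ := rfl
  right_inv _ := rfl

lemma verifierStep_eq_localApply
    (U : Matrix.unitaryGroup (Qubits (r + 1) × Qubits vX × Qubits vY) ℂ)
    (φ : Global r vX vY P Q → ℂ) : verifierStep U φ = localApply verifierEquiv U.1 φ := by
  ext ⟨z, x, y, p, q⟩
  simp [verifierStep, localApply, verifierEquiv, Fintype.sum_prod_type]

lemma verifierStep_sub (U : Matrix.unitaryGroup (Qubits (r + 1) × Qubits vX × Qubits vY) ℂ)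
    (φ χ : Global r vX vY P Q → ℂ) :
    verifierStep U (φ - χ) = verifierStep U φ - verifierStep U χ := by
  simp only [verifierStep_eq_localApply, localApply_sub]

/-- The projection onto the states in which the verifier's first private qubit is `1`. -/
def acceptPart (φ : Global r vX vY P Q → ℂ) : Global r vX vY P Q → ℂ :=
  fun g => if g.1 0 = true then φ g else 0

variable [Fintype P] [Fintype Q]

lemma l2norm_initialState (ψ : P × Q → ℂ) (hψ : IsState ψ) :
    l2norm (initialState ψ : Global r vX vY P Q → ℂ) = 1 := by
  have h : l2norm (initialState ψ : Global r vX vY P Q → ℂ) ^ 2 = 1 := by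
    rw [l2norm_sq, ← hψ]
    simp only [Fintype.sum_prod_type, initialState]
    rw [Finset.sum_eq_single (fun _ => false) (by intro c _ hc; simp [hc]) (by simp),
      Finset.sum_eq_single (fun _ => false) (by intro c _ hc; simp [hc]) (by simp),
      Finset.sum_eq_single (fun _ => false) (by intro c _ hc; simp [hc]) (by simp)]
    simp
  exact (pow_eq_one_iff_of_nonneg (l2norm_nonneg _) two_ne_zero).mp h

lemma l2norm_verifierStep_le
    (U : Matrix.unitaryGroup (Qubits (r + 1) × Qubits vX × Qubits vY) ℂ)
    (φ : Global r vX vY P Q → ℂ) : l2norm (verifierStep U φ) ≤ l2norm φ := by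
  rw [verifierStep_eq_localApply]
  exact l2norm_localApply_unitary_le _ _ _

lemma l2norm_acceptPart_sq (φ : Global r vX vY P Q → ℂ) :
    l2norm (acceptPart φ) ^ 2 = ∑ g, if g.1 0 = true then ‖φ g‖ ^ 2 else 0 := by
  rw [l2norm_sq]
  refine Finset.sum_congr rfl fun g _ => ?_
  simp only [acceptPart]
  split_ifs <;> simp

lemma l2norm_acceptPart_le (φ : Global r vX vY P Q → ℂ) : l2norm (acceptPart φ) ≤ l2norm φ := by
  refine le_of_sq_le_sq ?_ (l2norm_nonneg _)
  rw [l2norm_acceptPart_sq, l2norm_sq]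
  refine Finset.sum_le_sum fun g _ => ?_
  split_ifs <;> simp

variable [DecidableEq P] [DecidableEq Q]

lemma proverStep_eq_localApply (X : ProverUnitary vX P) (Y : ProverUnitary vY Q)
    (φ : Global r vX vY P Q → ℂ) :
    proverStep X Y φ =
      localApply firstProverEquiv X.1 (localApply secondProverEquiv Y.1 φ) := by
  ext ⟨z, x, y, p, q⟩
  simp only [proverStep, localApply, firstProverEquiv, secondProverEquiv, Fintype.sum_prod_type,
    Equiv.coe_fn_mk, Equiv.coe_fn_symm_mk, Finset.mul_sum, mul_assoc]
  refine Finset.sum_congr rfl fun x' _ => ?_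
  rw [Finset.sum_comm]

variable [Nonempty P] [Nonempty Q]

lemma l2norm_proverStep_le (X : ProverUnitary vX P) (Y : ProverUnitary vY Q)
    (φ : Global r vX vY P Q → ℂ) : l2norm (proverStep X Y φ) ≤ l2norm φ := by
  rw [proverStep_eq_localApply]
  exact (l2norm_localApply_unitary_le _ _ _).trans (l2norm_localApply_unitary_le _ _ _)

-- A hybrid argument: exchange the state, then `Y`, then `X`. Each of the last two exchanges costs
-- at most `δ`, as the other factors do not increase the norm.
open scoped Matrix.Norms.L2Operator in
lemma l2norm_proverStep_sub_le {δ : ℝ} (X X' : ProverUnitary vX P) (Y Y' : ProverUnitary vY Q)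
    (hX : ‖X.1 - X'.1‖ ≤ δ) (hY : ‖Y.1 - Y'.1‖ ≤ δ) (φ φ' : Global r vX vY P Q → ℂ)
    (hφ' : l2norm φ' ≤ 1) :
    l2norm (proverStep X Y φ - proverStep X' Y' φ') ≤ l2norm (φ - φ') + 2 * δ := by
  have hsplit : proverStep X Y φ - proverStep X' Y' φ' =
      proverStep X Y (φ - φ') +
        (localApply firstProverEquiv X.1 (localApply secondProverEquiv (Y.1 - Y'.1) φ') +
          localApply firstProverEquiv (X.1 - X'.1) (localApply secondProverEquiv Y'.1 φ')) := by
    simp only [proverStep_eq_localApply, localApply_sub, sub_localApply]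
    abel
  have hδ : 0 ≤ δ := (norm_nonneg _).trans hX
  have bound {t : ℝ} (ht : t ≤ δ) : t * l2norm φ' ≤ δ :=
    (mul_le_mul ht hφ' (l2norm_nonneg _) hδ).trans (mul_one δ).le
  have h1 := l2norm_proverStep_le X Y (φ - φ')
  have h2 : l2norm (localApply firstProverEquiv X.1
      (localApply secondProverEquiv (Y.1 - Y'.1) φ')) ≤ δ :=
    (l2norm_localApply_unitary_le _ _ _).trans ((l2norm_localApply_le _ _ _).trans (bound hY))
  have h3 : l2norm (localApply firstProverEquiv (X.1 - X'.1)
      (localApply secondProverEquiv Y'.1 φ')) ≤ δ :=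
    (l2norm_localApply_le _ _ _).trans ((mul_le_mul_of_nonneg_left
      (l2norm_localApply_unitary_le _ _ _) (norm_nonneg _)).trans (bound hX))
  rw [hsplit]
  linarith [l2norm_add_le (proverStep X Y (φ - φ'))
    (localApply firstProverEquiv X.1 (localApply secondProverEquiv (Y.1 - Y'.1) φ') +
      localApply firstProverEquiv (X.1 - X'.1) (localApply secondProverEquiv Y'.1 φ')),
    l2norm_add_le (localApply firstProverEquiv X.1 (localApply secondProverEquiv (Y.1 - Y'.1) φ'))
      (localApply firstProverEquiv (X.1 - X'.1) (localApply secondProverEquiv Y'.1 φ'))]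

lemma l2norm_runRounds_le (ψ : P × Q → ℂ) (hψ : IsState ψ) (n : ℕ)
    (V : Fin n → Matrix.unitaryGroup (Qubits (r + 1) × Qubits vX × Qubits vY) ℂ)
    (X : Fin n → ProverUnitary vX P) (Y : Fin n → ProverUnitary vY Q) :
    l2norm (runRounds ψ n V X Y) ≤ 1 := by
  induction n with
  | zero => exact (l2norm_initialState ψ hψ).le
  | succ n ih =>
    exact (l2norm_proverStep_le _ _ _).trans ((l2norm_verifierStep_le _ _).trans (ih _ _ _))

-- Both runs start in the same state and the verifier's steps do not increase distances, so only the
-- prover steps add error.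
open scoped Matrix.Norms.L2Operator in
lemma l2norm_runRounds_sub_le {δ : ℝ} (ψ : P × Q → ℂ) (hψ : IsState ψ) (n : ℕ)
    (V : Fin n → Matrix.unitaryGroup (Qubits (r + 1) × Qubits vX × Qubits vY) ℂ)
    (X X' : Fin n → ProverUnitary vX P) (Y Y' : Fin n → ProverUnitary vY Q)
    (hX : ∀ j, ‖(X j).1 - (X' j).1‖ ≤ δ) (hY : ∀ j, ‖(Y j).1 - (Y' j).1‖ ≤ δ) :
    l2norm (runRounds ψ n V X Y - runRounds ψ n V X' Y') ≤ n * (2 * δ) := by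
  induction n with
  | zero => simp [runRounds, l2norm]
  | succ n ih =>
    refine (l2norm_proverStep_sub_le _ _ _ _ (hX _) (hY _) _ _
      ((l2norm_verifierStep_le _ _).trans (l2norm_runRounds_le ψ hψ _ _ _ _))).trans ?_
    rw [← verifierStep_sub]
    have h1 := l2norm_verifierStep_le (V (Fin.last n))
      (runRounds ψ n (fun j => V j.castSucc) (fun j => X j.castSucc) (fun j => Y j.castSucc) -
        runRounds ψ n (fun j => V j.castSucc) (fun j => X' j.castSucc) (fun j => Y' j.castSucc))
    have h2 := ih (fun j => V j.castSucc) (fun j => X j.castSucc) (fun j => X' j.castSucc)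
      (fun j => Y j.castSucc) (fun j => Y' j.castSucc) (fun j => hX _) (fun j => hY _)
    push_cast
    linarith

open scoped Matrix.Norms.L2Operator in
lemma QuantumGame.value_sub_le {k : ℕ} {δ : ℝ} (G : QuantumGame k vX vY) (ψ : P × Q → ℂ)
    (hψ : IsState ψ) (X X' : Fin k → ProverUnitary vX P) (Y Y' : Fin k → ProverUnitary vY Q)
    (hX : ∀ j, ‖(X j).1 - (X' j).1‖ ≤ δ) (hY : ∀ j, ‖(Y j).1 - (Y' j).1‖ ≤ δ) :
    G.value ψ X' Y' - G.value ψ X Y ≤ 4 * k * δ := by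
  simp only [QuantumGame.value, ← l2norm_acceptPart_sq]
  set φ := runRounds ψ k (fun j => G.V j.castSucc) X Y with hφ
  set φ' := runRounds ψ k (fun j => G.V j.castSucc) X' Y' with hφ'
  set U := G.V (Fin.last k)
  have hb (χ : Global G.r vX vY P Q → ℂ) (h : l2norm χ ≤ 1) :
      l2norm (acceptPart (verifierStep U χ)) ≤ 1 :=
    (l2norm_acceptPart_le _).trans ((l2norm_verifierStep_le _ _).trans h)
  have h1 := hb φ (l2norm_runRounds_le ψ hψ _ _ _ _)
  have h2 := hb φ' (l2norm_runRounds_le ψ hψ _ _ _ _)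
  have hd : acceptPart (verifierStep U φ) - acceptPart (verifierStep U φ') =
      acceptPart (verifierStep U (φ - φ')) := by
    rw [verifierStep_sub]
    ext g
    simp only [acceptPart, Pi.sub_apply]
    split_ifs <;> simp
  have h3 : |l2norm (acceptPart (verifierStep U φ)) - l2norm (acceptPart (verifierStep U φ'))| ≤
      k * (2 * δ) := by
    refine (abs_l2norm_sub_le _ _).trans ?_
    rw [hd]
    exact (l2norm_acceptPart_le _).trans ((l2norm_verifierStep_le _ _).trans
      (l2norm_runRounds_sub_le ψ hψ k _ X X' Y Y' hX hY))
  have h4 := (abs_le.mp h3).1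
  -- Writing `s`, `s'` for the two norms, `s' ^ 2 - s ^ 2 = (s' - s) * (s' + s)` with `s + s' ≤ 2`,
  -- which doubles the error `2kδ`.
  nlinarith [l2norm_nonneg (acceptPart (verifierStep U φ)),
    l2norm_nonneg (acceptPart (verifierStep U φ')), abs_nonneg
      (l2norm (acceptPart (verifierStep U φ)) - l2norm (acceptPart (verifierStep U φ')))]

end Robustness

/-- A numbering of the basis labels of the program register. -/
noncomputable def programIndex (M : ℕ) : Qubits M ≃ Fin (2 ^ M) :=
  Fintype.equivFinOfCardEq (by simp)

theorem theorem3 (k : ℕ) (ε : ℝ) (hε : 0 < ε) :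
    ∃ X Y : ∀ M c m : ℕ, Fin k → ProverUnitary c (Qubits m × Qubits M),
      (∀ (M c m : ℕ) (j : Fin k), IsProgrammable (X M c m j) ∧ IsProgrammable (Y M c m j)) ∧
      ∀ vX vY m : ℕ, ∃ M₀ : ℕ, ∀ M : ℕ, M₀ ≤ M →
        ∀ (G : QuantumGame k vX vY) (ψ : Qubits m × Qubits m → ℂ), IsState ψ →
          ∀ (X' : Fin k → ProverUnitary vX (Qubits m)) (Y' : Fin k → ProverUnitary vY (Qubits m)),
            ∃ a b : Qubits M,
              G.value (withAncillas ψ (ket a) (ket b)) (X M vX m) (Y M vY m)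
                ≥ G.value ψ X' Y' - ε := by
  choose s hs using fun c m : ℕ => exists_seq_net (Qubits c × Qubits m) k
  -- One index determines the unitaries of all `k` rounds.
  let W (M c m : ℕ) (j : Fin k) (a : Qubits M) : ProverUnitary c (Qubits m) :=
    s c m (programIndex M a) j
  refine ⟨fun M c m j => programUnitary (W M c m j), fun M c m j => programUnitary (W M c m j),
    fun M c m j => ⟨isProgrammable_programUnitary _, isProgrammable_programUnitary _⟩,
    fun vX vY m => ?_⟩
  -- Chosen so that `4kδ ≤ ε`; the `+ 1` covers `k = 0`.
  have hδ : 0 < ε / (4 * k + 1) := by positivity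
  obtain ⟨N, hN⟩ := hs vX m _ hδ
  obtain ⟨N', hN'⟩ := hs vY m _ hδ
  refine ⟨max N N', fun M hM G ψ hψ X' Y' => ?_⟩
  obtain ⟨n, hn, hX⟩ := hN X'
  obtain ⟨n', hn', hY⟩ := hN' Y'
  -- Hence `n` and `n'`, which are below `M`, are indices of programs.
  have hpow : M < 2 ^ M := Nat.lt_two_pow_self
  refine ⟨(programIndex M).symm ⟨n, by omega⟩, (programIndex M).symm ⟨n', by omega⟩, ?_⟩
  rw [QuantumGame.value_withAncillas]
  have h := G.value_sub_le ψ hψ (s vX m n) X' (s vY m n') Y' hX hY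
  have hε' : 4 * k * (ε / (4 * k + 1)) ≤ ε := by
    rw [mul_div_assoc', div_le_iff₀ (by positivity)]
    nlinarith
  simp only [W, Equiv.apply_symm_apply]
  linarith
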